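/- Let $G=(V,E)$ be a finite simple connected graph. In the majority dynamics on $G$, a configuration $x\in\{0,1\}^V$ evolves synchronously from $x^0=x$: $x^{t+1}_u=1$ if more than half of the neighbours of $u$ have state $1$ in $x^t$, $x^{t+1}_u=x^t_u$ if exactly half of them do, and $x^{t+1}_u=0$ otherwise. Consider the languages \[\textsc{Election-Prediction}=\Big\{(G,(x,T)) : T>0,\ \sum_{v\in V}x^T_v>\tfrac{|V|}{2}\Big\},\qquad \textsc{Majority-Prediction}=\big\{(G,(x,y,T)) : T>0,\ x^T=y\big\},\] where $x,y\in\{0,1\}^V$ and the input of a node $v$ is $(x_v,T)$, respectively $(x_v,y_v,T)$. The nodes of an $n$-node graph carry distinct identifiers from $\{1,\dots,n^c\}$, for some fixed $c>1$. A locally checkable proof of radius $r$ for such a language $\mathcal L$ consists of a prover, who assigns to each node a certificate (a bit string, which may depend on the whole instance and on the identifiers), and a verifier, who at each node $v$ accepts or rejects, as an arbitrary function of $n$ and of the subgraph induced by the nodes at distance at most $r$ from $v$, together with their identifiers, inputs and certificates. On every instance in $\mathcal L$ (a connected graph with inputs), under every identifier assignment, the prover's certificates make all nodes accept; on every instance not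 in $\mathcal L$, under every identifier assignment and for every certificate assignment, at least one node rejects. Its certificate size $s(n)$ is a bound on the number of bits of the prover's certificates on $n$-node graphs. Then every locally checkable proof, of any constant radius $r$, for Election-Prediction or for Majority-Prediction has certificates of $\Omega(n)$ bits: for every $r$ there are $\kappa>0$ and $N$ such that, for every $c>1$ and every locally checkable proof of radius $r$ for one of these two languages, $s(n)\ge\kappa n$ for all $n\ge N$. -/

import Mathlib

namespace MajorityDynamics

/-! ### Majority dynamics -/

open Classical in
/-- Number of neighbours of `v` whose opinion is `1` (`true`) in the configuration `x`. -/
noncomputable def onesAround {V : Type} [Fintype V] (G : SimpleGraph V) (x : V → Bool) (v : V) : ℕ :=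
  ((G.neighborFinset v).filter (fun u => x u = true)).card

open Classical in
/-- One synchronous step of the majority rule; in a tie a node keeps its opinion. -/
noncomputable def majorityStep {V : Type} [Fintype V] (G : SimpleGraph V) (x : V → Bool) : V → Bool :=
  fun v =>
    if G.degree v < 2 * onesAround G x v then true
    else if 2 * onesAround G x v = G.degree v then x v
    else false

/-- The configuration `x^t` at time `t`, starting from `x^0 = x`. -/
noncomputable def orbit {V : Type} [Fintype V] (G : SimpleGraph V) (x : V → Bool) (t : ℕ) : V → Bool :=
  (majorityStep G)^[t] x

/-! ### Distributed languages -/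

/-- A distributed language whose instances are a graph, a local state in `S` at each node, and a
time `T` given to all nodes. The input of the node `v` is the pair `(s v, T)`. -/
def TimedLanguage (S : Type) : Type 1 :=
  ∀ (V : Type) [Fintype V], SimpleGraph V → (V → S) → ℕ → Prop

/-- Election prediction: at time `T > 0` more than half of the nodes have opinion `1`. -/
def ElectionPrediction : TimedLanguage Bool :=
  fun V _ G x T =>
    0 < T ∧ (Fintype.card V : ℝ) / 2 <
      ((Finset.univ.filter (fun v : V => orbit G x T v = true)).card : ℝ)

/-- Majority prediction: the local state of `v` is the pair `(x v, y v)`, and the configuration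
at time `T > 0` is `y`. -/
def MajorityPrediction : TimedLanguage (Bool × Bool) :=
  fun _ _ G s T => 0 < T ∧ orbit G (fun v => (s v).1) T = fun v => (s v).2

/-! ### Locally checkable proofs -/

/-- `id` is an injective assignment of identifiers in `{1, …, n ^ c}`, `n` the number of nodes. -/
def IsIdAssignment {V : Type} [Fintype V] (c : ℝ) (id : V → ℕ) : Prop :=
  Function.Injective id ∧ ∀ v, 1 ≤ id v ∧ (id v : ℝ) ≤ (Fintype.card V : ℝ) ^ c

/-- What a node may see: its own identifier, a set of nodes, each given by its identifier, its
input and its certificate, and the set of edges between these, given by identifiers. As identifiers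
are unique, this describes a labelled graph completely. -/
structure View (I : Type) where
  center : ℕ
  nodes : Set (ℕ × I × List Bool)
  edges : Set (ℕ × ℕ)

/-- The view of `v`: the subgraph induced by the nodes at distance at most `r` from `v`, with their
identifiers, inputs and certificates. -/
def localView {V I : Type} (G : SimpleGraph V) (id : V → ℕ) (inp : V → I) (cert : V → List Bool)
    (r : ℕ) (v : V) : View I where
  center := id v
  nodes := {q | ∃ u, G.edist v u ≤ (r : ℕ∞) ∧ q = (id u, inp u, cert u)}
  edges := {e | ∃ u w, G.edist v u ≤ (r : ℕ∞) ∧ G.edist v w ≤ (r : ℕ∞) ∧ G.Adj u w ∧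
    e = (id u, id w)}

/-- A locally checkable proof for `L`, on connected graphs with identifiers in `{1, …, n ^ c}`, with
verification radius `r`. The verifier is an arbitrary predicate of the number of nodes and of the
view; `size n` bounds the number of bits that the prover's certificates use on `n`-node graphs. -/
structure LocallyCheckableProof {S : Type} (L : TimedLanguage S) (c : ℝ) (r : ℕ) where
  accepts : ℕ → View (S × ℕ) → Prop
  size : ℕ → ℕ
  complete : ∀ (V : Type) [Fintype V] (G : SimpleGraph V) (id : V → ℕ) (s : V → S) (T : ℕ),
    G.Connected → IsIdAssignment c id → L V G s T →
      ∃ cert : V → List Bool, (∀ v, (cert v).length ≤ size (Fintype.card V)) ∧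
        ∀ v, accepts (Fintype.card V) (localView G id (fun u => (s u, T)) cert r v)
  sound : ∀ (V : Type) [Fintype V] (G : SimpleGraph V) (id : V → ℕ) (s : V → S) (T : ℕ),
    G.Connected → IsIdAssignment c id → ¬ L V G s T →
      ∀ cert : V → List Bool,
        ∃ v, ¬ accepts (Fintype.card V) (localView G id (fun u => (s u, T)) cert r v)

end MajorityDynamics

/-! The proof is a fooling-set argument. For sets `X`, `Y` in an `M`-element universe, a gadget
graph is built whose yes-instances are exactly the pairs with `X ⊆ Y`. The graph on the left of a
separator depends on `X` only, the graph on the right on `Y` only; inputs and time are fixed. If the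
certificates for `(X, X)` and `(Y, Y)` agree on the separator, they can be glued to make every node
accept on `(X, Y)` and on `(Y, X)`. Soundness then gives both inclusions, so `X = Y`. Hence the
separator carries `2 ^ M` different certificates (`card_le_of_fooling`). For fixed `r` it has
boundedly many nodes, while `M` is linear in `n`, so some certificate has linearly many bits.

The gadget is a small graph with weighted cells, realised by independent twins (`orbit_blowup`).
Clocks on each side turn one per step. The sender turns the elements of `X` into pulses on a wire
whose decreasing weights make them travel one way. At the far end the receiver cancels the pulses of
elements of `Y`. A surviving pulse is stored for ever in the pair formed by the last wire cell and
the memory. `field_pos` checks each cell with a strict majority, so the tie rule never acts.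
Finally, leaf sizes are tuned (`exists_leaf_sizes`) so that one surviving pulse also decides the
election. -/

namespace MajorityDynamics

/-! ### Blow-ups of a graph -/

/-- The sign of an opinion. -/
def sgn (b : Bool) : ℤ := if b then 1 else -1

theorem sgn_true : sgn true = 1 := rfl

theorem sgn_false : sgn false = -1 := rfl

theorem sgn_not (b : Bool) : sgn (!b) = -sgn b := by cases b <;> rfl

theorem abs_sgn (b : Bool) : |sgn b| = 1 := by cases b <;> rfl

/-- The signed sum is twice the number of ones minus the degree, so a strict sign rules out a tie.
-/
theorem majorityStep_eq_of_sum_pos {V : Type} [Fintype V] (G : SimpleGraph V) [DecidableRel G.Adj]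
    (x : V → Bool) (v : V) (b : Bool)
    (h : 0 < sgn b * ∑ u, if G.Adj v u then sgn (x u) else 0) : majorityStep G x v = b := by
  obtain rfl : ‹DecidableRel G.Adj› = fun _ _ => Classical.propDecidable _ := Subsingleton.elim _ _
  classical
  have key : (∑ u, if G.Adj v u then sgn (x u) else 0)
      = 2 * (onesAround G x v : ℤ) - (G.degree v : ℤ) := by
    have h1 : (∑ u, if G.Adj v u then sgn (x u) else 0) = ∑ u ∈ G.neighborFinset v, sgn (x u) := by
      rw [← Finset.sum_filter]
      congr 1
      ext u
      simp
    have h2 : ∀ u, sgn (x u) = 2 * (if x u = true then 1 else 0) - 1 := by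
      intro u
      cases x u <;> rfl
    rw [h1, Finset.sum_congr rfl fun u _ => h2 u, Finset.sum_sub_distrib, ← Finset.mul_sum,
      Finset.sum_boole, Finset.sum_const, SimpleGraph.card_neighborFinset_eq_degree]
    unfold onesAround
    simp only [nsmul_eq_mul, mul_one]
  rw [key] at h
  unfold majorityStep
  cases b
  · simp only [sgn, Bool.false_eq_true, if_false] at h
    rw [if_neg (by omega), if_neg (by omega)]
  · simp only [sgn, if_true] at h
    rw [if_pos (by omega)]

/-- The blow-up of `H`: every node `k` is replaced by `size k` independent copies. -/
abbrev blowup {C : Type} (H : SimpleGraph C) (size : C → ℕ) : SimpleGraph (Σ k, Fin (size k)) :=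
  H.comap Sigma.fst

/-- Copies of a cell have the same neighbours, so they keep a common opinion and `size` acts as a
weight in the majority. -/
theorem orbit_blowup {C : Type} [Fintype C] (H : SimpleGraph C) [DecidableRel H.Adj] (size : C → ℕ)
    (x : ℕ → C → Bool)
    (h : ∀ t k, 0 < sgn (x (t + 1) k) * ∑ l, if H.Adj k l then (size l : ℤ) * sgn (x t l) else 0)
    (t : ℕ) : orbit (blowup H size) (fun v => x 0 v.1) t = fun v => x t v.1 := by
  induction t with
  | zero => rfl
  | succ t ih =>
    rw [orbit, Function.iterate_succ_apply', ← orbit, ih]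
    funext v
    apply majorityStep_eq_of_sum_pos
    convert h t v.1 using 2
    rw [Fintype.sum_sigma]
    refine Finset.sum_congr rfl fun l _ => ?_
    by_cases hl : H.Adj v.1 l <;> simp [hl]

/-- All copies of `k` are connected to all copies of `l`. -/
def Joined {C : Type} (H : SimpleGraph C) (size : C → ℕ) (k l : C) : Prop :=
  ∀ i j, (blowup H size).Reachable ⟨k, i⟩ ⟨l, j⟩

section Joined

variable {C : Type} {H : SimpleGraph C} {size : C → ℕ} {k l o : C}

theorem Joined.of_adj (h : H.Adj k l) : Joined H size k l := fun _ _ =>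
  SimpleGraph.Adj.reachable (by simpa using h)

theorem Joined.symm (h : Joined H size k l) : Joined H size l k := fun i j => (h j i).symm

theorem Joined.trans (hl : 0 < size l) (h : Joined H size k l) (h' : Joined H size l o) :
    Joined H size k o := fun i j => (h i ⟨0, hl⟩).trans (h' ⟨0, hl⟩ j)

theorem connected_blowup (hl : 0 < size l) (h : ∀ k, Joined H size l k) :
    (blowup H size).Connected where
  preconnected u v := (h u.1 ⟨0, hl⟩ u.2).symm.trans (h v.1 ⟨0, hl⟩ v.2)
  nonempty := ⟨⟨l, ⟨0, hl⟩⟩⟩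

end Joined

/-! ### Cutting an instance in two -/

/-- The level grows by at most one per step, so a short walk never leaves the region where the edges
of `G` are edges of `G'`. -/
theorem edist_le_of_agree {V : Type} {G G' : SimpleGraph V} (level : V → ℕ) (D : ℕ)
    (hlip : ∀ u v, G.Adj u v → level v ≤ level u + 1)
    (hagree : ∀ u v, level u < D → level v < D → G.Adj u v → G'.Adj u v) {v u : V}
    (p : G.Walk v u) : level v + p.length < D →
      level u ≤ level v + p.length ∧ G'.edist v u ≤ p.length := by
  induction p with
  | nil => intro _; simp
  | @cons a b c hab q ih =>
    intro h
    rw [SimpleGraph.Walk.length_cons] at h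
    have h1 := hlip a b hab
    obtain ⟨h2, h3⟩ := ih (by omega)
    refine ⟨by rw [SimpleGraph.Walk.length_cons]; omega, ?_⟩
    have hab' : G'.Adj a b := hagree a b (by omega) (by omega) hab
    calc G'.edist a c ≤ G'.edist a b + G'.edist b c := SimpleGraph.edist_triangle
      _ ≤ 1 + q.length := by
        gcongr
        exact (SimpleGraph.edist_eq_one_iff_adj.2 hab').le
      _ = _ := by rw [SimpleGraph.Walk.length_cons]; push_cast; ring

theorem ball_subset_of_agree {V : Type} {G G' : SimpleGraph V} (level : V → ℕ) (D r : ℕ)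
    (hlip : ∀ u v, G.Adj u v → level v ≤ level u + 1)
    (hagree : ∀ u v, level u < D → level v < D → G.Adj u v → G'.Adj u v) {v u : V}
    (hv : level v + r < D) (h : G.edist v u ≤ (r : ℕ∞)) :
    level u < D ∧ G'.edist v u ≤ (r : ℕ∞) := by
  have hne : G.edist v u ≠ ⊤ := ne_top_of_le_ne_top (ENat.natCast_ne_top r) h
  obtain ⟨p, hp⟩ := SimpleGraph.exists_walk_of_edist_ne_top hne
  have hpr : p.length ≤ r := by
    rw [← hp] at h
    exact_mod_cast h
  obtain ⟨h1, h2⟩ := edist_le_of_agree level D hlip hagree p (by omega)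
  exact ⟨by omega, h2.trans (by exact_mod_cast hpr)⟩

theorem localView_eq_of_agree {V I : Type} {G G' : SimpleGraph V} (level : V → ℕ) (D r : ℕ)
    (hlip : ∀ u v, G.Adj u v → level v ≤ level u + 1)
    (hlip' : ∀ u v, G'.Adj u v → level v ≤ level u + 1)
    (hagree : ∀ u v, level u < D → level v < D → (G.Adj u v ↔ G'.Adj u v))
    (id : V → ℕ) (inp : V → I) (cert cert' : V → List Bool)
    (hcert : ∀ u, level u < D → cert u = cert' u) {v : V} (hv : level v + r < D) :
    localView G id inp cert r v = localView G' id inp cert' r v := by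
  have h1 := fun u => ball_subset_of_agree (u := u) level D r hlip
    (fun u v hu hv => (hagree u v hu hv).1) hv
  have h2 := fun u => ball_subset_of_agree (u := u) level D r hlip'
    (fun u v hu hv => (hagree u v hu hv).2) hv
  unfold localView
  congr 1
  · ext q
    constructor
    · rintro ⟨u, hu, rfl⟩
      exact ⟨u, (h1 u hu).2, by rw [hcert u (h1 u hu).1]⟩
    · rintro ⟨u, hu, rfl⟩
      exact ⟨u, (h2 u hu).2, by rw [hcert u (h2 u hu).1]⟩
  · ext q
    constructor
    · rintro ⟨u, w, hu, hw, huw, rfl⟩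
      exact ⟨u, w, (h1 u hu).2, (h1 w hw).2, (hagree u w (h1 u hu).1 (h1 w hw).1).1 huw, rfl⟩
    · rintro ⟨u, w, hu, hw, huw, rfl⟩
      exact ⟨u, w, (h2 u hu).2, (h2 w hw).2, (hagree u w (h2 u hu).1 (h2 w hw).1).2 huw, rfl⟩

/-- The fooling set bound: the nodes of level strictly between `0` and `D` separate the part of the
graph that depends on the first parameter from the part that depends on the second one. -/
theorem card_le_of_fooling {S : Type} {L : TimedLanguage S} {c : ℝ} {r : ℕ}
    (P : LocallyCheckableProof L c r) {V : Type} [Fintype V] {ι : Type} [Fintype ι]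
    (G : ι → ι → SimpleGraph V) (id : V → ℕ) (s : V → S) (T : ℕ) (level : V → ℕ) (D : ℕ)
    (hD : 2 * r < D) (hid : IsIdAssignment c id) (hconn : ∀ a b, (G a b).Connected)
    (hlip : ∀ a b u v, (G a b).Adj u v → level v ≤ level u + 1)
    (hleft : ∀ a b b' u v, level u < D → level v < D → ((G a b).Adj u v ↔ (G a b').Adj u v))
    (hright : ∀ a a' b u v, 0 < level u → 0 < level v → ((G a b).Adj u v ↔ (G a' b).Adj u v))
    (hyes : ∀ a, L V (G a a) s T) (hno : ∀ a b, L V (G a b) s T → L V (G b a) s T → a = b) :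
    Fintype.card ι ≤
      3 ^ (P.size (Fintype.card V) * Fintype.card {v : V // 0 < level v ∧ level v < D}) := by
  classical
  choose cert hlen hacc using fun a => P.complete V (G a a) id s T (hconn a a) hid (hyes a)
  -- Certificates of `a` are kept below level `D` and those of `b` at the far end. Since `2 * r <
  -- D`, no view meets both level `0` and the levels from `D` on.
  have mix : ∀ a b, (∀ v, 0 < level v → level v < D → cert a v = cert b v) → L V (G a b) s T := by
    intro a b hab
    by_contra hL
    obtain ⟨v, hv⟩ := P.sound V (G a b) id s T (hconn a b) hid hL
      (fun v => if level v < D then cert a v else cert b v)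
    apply hv
    by_cases hr : level v ≤ r
    · rw [localView_eq_of_agree level D r (hlip a b) (hlip a a) (hleft a b a) id _ _ (cert a)
        (fun u hu => if_pos hu) (by omega)]
      exact hacc a v
    -- The same locality argument, with levels counted from the receiver's end.
    · rw [localView_eq_of_agree (fun v => D - level v) D r (G' := G b b) _ _ _ id _ _ (cert b) _]
      · exact hacc b v
      · omega
      · intro u v huv
        have := hlip _ _ _ _ huv.symm
        omega
      · intro u v huv
        have := hlip _ _ _ _ huv.symm
        omega
      · intro u v hu hv
        exact hright a b b u v (by omega) (by omega)
      · intro u hu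
        split_ifs with h
        · exact hab u (by omega) h
        · rfl
  -- Certificates may be shorter than the bound; `none` marks positions past the end, whence the
  -- base `3`.
  let code : ι → ({v : V // 0 < level v ∧ level v < D} → Fin (P.size (Fintype.card V)) → Option Bool)
    := fun a v i => (cert a v)[(i : ℕ)]?
  have hcode : Function.Injective code := by
    intro a b hab
    have h : ∀ v, 0 < level v → level v < D → cert a v = cert b v := by
      intro v h0 hD
      apply List.ext_getElem?
      intro i
      by_cases hi : i < P.size (Fintype.card V)
      · exact congrFun (congrFun hab ⟨v, h0, hD⟩) ⟨i, hi⟩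
      · rw [List.getElem?_eq_none ((hlen a v).trans (by omega)),
          List.getElem?_eq_none ((hlen b v).trans (by omega))]
    exact hno a b (mix a b h) (mix b a fun v h0 hD => (h v h0 hD).symm)
  have := Fintype.card_le_of_injective code hcode
  simpa [← pow_mul] using this

/-! ### The gadget -/

/-- The classes of nodes of the gadget. There are two sides, `true` (the sender) and `false` (the
receiver). On each side and for each opinion `b`, the class `source` has opinion `b` for ever, held
up by its leaves, and the classes `clock` turn to `b` one after the other. A wire leads from the
sender to the receiver, and `memory` keeps blinking once a signal has passed through it. -/
inductive Cell (L m : ℕ) : Type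
  | source (side b : Bool)
  | leaf (side b : Bool)
  | clock (side b : Bool) (i : Fin m)
  | wire (j : Fin (L + 2))
  | memory

namespace Cell

variable {L m : ℕ}

/-- Cells as a sum type. -/
def equivSum : Cell L m ≃
    (Bool × Bool) ⊕ (Bool × Bool) ⊕ (Bool × Bool × Fin m) ⊕ Fin (L + 2) ⊕ Unit where
  toFun
    | source s b => .inl (s, b)
    | leaf s b => .inr (.inl (s, b))
    | clock s b i => .inr (.inr (.inl (s, b, i)))
    | wire j => .inr (.inr (.inr (.inl j)))
    | memory => .inr (.inr (.inr (.inr ())))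
  invFun
    | .inl (s, b) => source s b
    | .inr (.inl (s, b)) => leaf s b
    | .inr (.inr (.inl (s, b, i))) => clock s b i
    | .inr (.inr (.inr (.inl j))) => wire j
    | .inr (.inr (.inr (.inr ()))) => memory
  left_inv k := by cases k <;> rfl
  right_inv k := by rcases k with _ | _ | _ | _ | _ <;> rfl

instance : Fintype (Cell L m) := Fintype.ofEquiv _ equivSum.symm

theorem sum_eq {A : Type} [AddCommMonoid A] (f : Cell L m → A) :
    ∑ k, f k = (∑ s, ∑ b, f (source s b)) + ((∑ s, ∑ b, f (leaf s b)) +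
      ((∑ s, ∑ b, ∑ i, f (clock s b i)) + ((∑ j, f (wire j)) + f memory))) := by
  rw [← equivSum.symm.sum_comp]
  simp only [Fintype.sum_sum_type, Fintype.sum_prod_type, Finset.univ_unique, Finset.sum_singleton]
  rfl

/-- The clock `i` for the opinion `b` on side `s` is attached to the wire, when the side `s` is to
be active at the times in `Z`. -/
def tap (Z : ℕ → Bool) (s b : Bool) (i : ℕ) : Bool :=
  if b = s then Z i else decide (1 ≤ i) && Z (i - 1)

/-- The end of the wire on side `s`. -/
def hub (L : ℕ) (s : Bool) : ℕ := if s then 0 else L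

/-- The edges between cells, in one direction. -/
def link (Z : Bool → ℕ → Bool) : Cell L m → Cell L m → Bool
  | source s b, leaf s' b' => decide (s' = s ∧ b' = b)
  | source s b, clock s' b' i => decide (s' = s ∧ (b' = b ∨ (i : ℕ) + 1 = m))
  | source s b, wire j => decide (s = true ∧ b = false ∧ (j : ℕ) = 0) ||
      decide (s = false ∧ b = true ∧ (j : ℕ) = L + 1)
  | clock s b i, clock s' b' i' => decide (s' = s ∧ b' = b ∧ (i' : ℕ) = i + 1)
  | clock s b i, wire j => tap (Z s) s b i && decide ((j : ℕ) = hub L s)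
  | wire j, wire j' => decide ((j' : ℕ) = j + 1)
  | wire j, memory => decide ((j : ℕ) = L + 1)
  | _, _ => false

/-- The graph of cells. -/
def graph (L m : ℕ) (Z : Bool → ℕ → Bool) : SimpleGraph (Cell L m) where
  Adj k l := (link Z k l || link Z l k) = true
  symm := ⟨fun k l h => by rwa [Bool.or_comm]⟩
  loopless := ⟨fun k h => by cases k <;> simp [link] at h⟩

instance (Z : Bool → ℕ → Bool) : DecidableRel (graph L m Z).Adj :=
  fun _ _ => inferInstanceAs (Decidable (_ = true))

theorem graph_adj {Z : Bool → ℕ → Bool} {k l : Cell L m} :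
    (graph L m Z).Adj k l ↔ (link Z k l = true ∨ link Z l k = true) := by
  simp [graph]

/-- The sizes of the cells, given those of the leaves. -/
def size (K : Bool → Bool → ℕ) : Cell L m → ℕ
  | source _ _ => 3 * (L + 3)
  | leaf s b => K s b
  | clock _ _ _ => 2 * (L + 3)
  | wire j => L + 2 - j
  | memory => 3 * (L + 3)

/-- The receiver's end of the wire: active at time `t` if a signal of the sender arrives and the
receiver does not suppress it. Before the end, there is no suppression. -/
def pulse (L : ℕ) (Z : Bool → ℕ → Bool) (j t : ℕ) : Bool :=
  decide (j + 2 ≤ t) && Z true (t - 2 - j) && (decide (j < L) || !Z false (t - 2))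

/-- The states of the last cell of the wire and of the memory. -/
def latch (L : ℕ) (Z : Bool → ℕ → Bool) : ℕ → Bool × Bool
  | 0 => (false, false)
  | t + 1 => (pulse L Z L t || (latch L Z t).2, (latch L Z t).1)

/-- The state of each cell at time `t`. -/
def state (Z : Bool → ℕ → Bool) (t : ℕ) : Cell L m → Bool
  | source _ b => b
  | leaf _ b => b
  | clock _ b i => if (i : ℕ) < t then b else !b
  | wire j => if (j : ℕ) = L + 1 then (latch L Z t).1 else pulse L Z j t
  | memory => (latch L Z t).2

/-- The weighted sum of the opinions around a cell. -/
def field (K : Bool → Bool → ℕ) (Z : Bool → ℕ → Bool) (t : ℕ) (k : Cell L m) : ℤ :=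
  ∑ l, if (graph L m Z).Adj k l then (size K l : ℤ) * sgn (state Z t l) else 0

/-! ### Weighted opinions around each cell -/

section Field

variable {K : Bool → Bool → ℕ} {Z : Bool → ℕ → Bool} {t : ℕ}

theorem field_leaf (s b : Bool) :
    field K Z t (leaf s b : Cell L m) = 3 * (L + 3) * sgn b := by
  rw [field, sum_eq]
  simp only [graph_adj, link, size, state]
  cases s <;> cases b <;> simp

theorem field_memory :
    field K Z t (memory : Cell L m) = sgn (latch L Z t).1 := by
  rw [field, sum_eq]
  simp only [graph_adj, link, size, state]
  rw [Finset.sum_eq_single (Fin.last (L + 1))]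
  · simp
  · intro j _ hj
    rw [if_neg]
    simpa [Fin.ext_iff] using hj
  · simp

/-- The total size of the cells other than the leaves. -/
def core (L m : ℕ) : ℕ :=
  15 * (L + 3) + 8 * m * (L + 3) + ∑ j : Fin (L + 2), (L + 2 - (j : ℕ))

theorem field_source (s b : Bool) :
    (K s b : ℤ) - core L m ≤ sgn b * field K Z t (source s b : Cell L m) := by
  have hle : ∀ (p : Prop) [Decidable p] (a : ℤ) (c : Bool), 0 ≤ a →
      -a ≤ sgn b * (if p then a * sgn c else 0) := by
    intro p _ a c ha
    split_ifs
    · cases b <;> cases c <;> simp [sgn] <;> omega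
    · simpa using ha
  have hb : sgn b * sgn b = 1 := by cases b <;> rfl
  -- Worst case: every cell other than the source's own leaves opposes it with its full weight.
  let H : Cell L m → ℤ
    | leaf s' b' => if s' = s ∧ b' = b then K s b else 0
    | k => -(size K k : ℤ)
  have hH : ∑ k, H k = (K s b : ℤ) - core L m := by
    rw [sum_eq]
    simp only [H, size, core]
    cases s <;> cases b <;> simp <;> ring
  rw [← hH, field, Finset.mul_sum]
  refine Finset.sum_le_sum fun k _ => ?_
  cases k with
  | leaf s' b' =>
    simp only [H, graph_adj, link, size, state]
    by_cases h : s' = s ∧ b' = b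
    · obtain ⟨rfl, rfl⟩ := h
      simp only [and_self, decide_true, true_or, if_true]
      rw [mul_left_comm, hb, mul_one]
    · simp [h]
  | source => exact hle _ _ _ (by positivity)
  | clock => exact hle _ _ _ (by positivity)
  | wire => exact hle _ _ _ (by positivity)
  | memory => exact hle _ _ _ (by positivity)

theorem sum_neighbors (n i : ℕ) (hi : i < n) (f : ℕ → ℤ) :
    (∑ l : Fin n, if (l : ℕ) = i + 1 ∨ i = (l : ℕ) + 1 then f l else 0) =
      (if i + 1 < n then f (i + 1) else 0) + (if 1 ≤ i then f (i - 1) else 0) := by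
  rw [Fin.sum_univ_eq_sum_range (fun l => if l = i + 1 ∨ i = l + 1 then f l else 0) n]
  have h : ∀ l, (if l = i + 1 ∨ i = l + 1 then f l else 0) =
      (if l = i + 1 then f l else 0) + (if l = i - 1 then (if 1 ≤ i then f l else 0) else 0) := by
    intro l
    split_ifs <;> omega
  simp_rw [h, Finset.sum_add_distrib, Finset.sum_ite_eq', Finset.mem_range]
  rw [if_pos (show i - 1 < n by omega)]

/-- A clock touches at most one wire cell, of size at most `L + 2`. This is below the unit `L + 3`
of the other terms, so the wire cannot disturb the clocks. -/
theorem field_clock (s b : Bool) (i : Fin m) :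
    |field K Z t (clock s b i : Cell L m) - sgn b * ((L + 3) *
      (3 + (if (i : ℕ) + 1 < m then (if (i : ℕ) + 1 < t then 2 else -2) else -3) +
        (if 1 ≤ (i : ℕ) then (if (i : ℕ) - 1 < t then 2 else -2) else 0)))| ≤ L + 2 := by
  have hwire : |∑ j : Fin (L + 2), if (tap (Z s) s b i && decide ((j : ℕ) = hub L s)) = true then
      (((L + 2 - (j : ℕ) : ℕ) : ℤ) * sgn (state Z t (wire j : Cell L m))) else 0| ≤ L + 2 := by
    have hub_lt : hub L s < L + 2 := by unfold hub; split_ifs <;> omega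
    rw [Finset.sum_eq_single ⟨hub L s, hub_lt⟩]
    · split_ifs
      · rw [abs_mul, abs_sgn, mul_one, Nat.abs_cast]
        omega
      · simp; omega
    · intro j _ hj
      rw [if_neg]
      simp only [ne_eq, Fin.ext_iff] at hj
      simp [hj]
    · simp
  have hclock := sum_neighbors m i i.2
    (fun l => (2 * (L + 3) : ℕ) * sgn (if l < t then b else !b))
  have hsum : field K Z t (clock s b i : Cell L m) =
      3 * (L + 3) * sgn b + (if (i : ℕ) + 1 = m then 3 * (L + 3) * sgn (!b) else 0) +
      (∑ l : Fin m, if (l : ℕ) = i + 1 ∨ (i : ℕ) = (l : ℕ) + 1 then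
        ((2 * (L + 3) : ℕ) : ℤ) * sgn (if (l : ℕ) < t then b else !b) else 0) +
      ∑ j : Fin (L + 2), if (tap (Z s) s b i && decide ((j : ℕ) = hub L s)) = true then
      (((L + 2 - (j : ℕ) : ℕ) : ℤ) * sgn (state Z t (wire j : Cell L m))) else 0 := by
    rw [field, sum_eq]
    simp only [graph_adj, link, size]
    cases s <;> cases b <;> simp [state, add_assoc]
    all_goals exact add_left_comm _ _ _
  rw [hsum, hclock]
  generalize (∑ j : Fin (L + 2), if (tap (Z s) s b i && decide ((j : ℕ) = hub L s)) = true then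
      (((L + 2 - (j : ℕ) : ℕ) : ℤ) * sgn (state Z t (wire j : Cell L m))) else 0) = W at hwire ⊢
  refine le_of_eq_of_le ?_ hwire
  congr 1
  have hsgn : ∀ p : Prop, [Decidable p] → sgn (if p then b else !b) =
      sgn b * (if p then 1 else -1) := by
    intro p _
    split_ifs <;> simp [sgn_not]
  simp only [hsgn, sgn_not]
  generalize sgn b = e
  have := i.2
  split_ifs <;> first | omega | (push_cast; ring)

/-- An active time `i` taps clock `i` for opinion `s` and clock `i + 1` for the opposite one. They
cancel when neither or both have turned, and agree on `s` only at time `i + 1`. The hypothesis on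
`Z` ensures that clock `i + 1` exists. -/
theorem sum_tap (s : Bool) (hZ : ∀ i, m ≤ i + 1 → Z s i = false) (a : ℤ) :
    (∑ b, ∑ i : Fin m, if tap (Z s) s b i = true then
      a * sgn (if (i : ℕ) < t then b else !b) else 0) =
    if 1 ≤ t ∧ Z s (t - 1) = true then 2 * a * sgn s else 0 := by
  obtain _ | m := m
  · rw [if_neg]
    · simp
    · simp [hZ]
  have h1 : (∑ i : Fin (m + 1), if tap (Z s) s s i = true then
      a * sgn (if (i : ℕ) < t then s else !s) else 0) =
      ∑ i ∈ Finset.range m, if Z s i = true then a * sgn (if i < t then s else !s) else 0 := by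
    rw [Fin.sum_univ_eq_sum_range (fun i => if tap (Z s) s s i = true then
      a * sgn (if i < t then s else !s) else 0) (m + 1), Finset.sum_range_succ]
    simp [tap, hZ m le_rfl]
  have h2 : (∑ i : Fin (m + 1), if tap (Z s) s (!s) i = true then
      a * sgn (if (i : ℕ) < t then !s else !!s) else 0) =
      ∑ i ∈ Finset.range m, if Z s i = true then a * sgn (if i + 1 < t then !s else s) else 0 := by
    rw [Fin.sum_univ_eq_sum_range (fun i => if tap (Z s) s (!s) i = true then
      a * sgn (if i < t then !s else !!s) else 0) (m + 1), Finset.sum_range_succ']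
    simp [tap]
  have h3 : ∀ g : Bool → ℤ, ∑ b, g b = g s + g (!s) := by
    intro g
    cases s <;> simp [add_comm]
  rw [h3, h1, h2, ← Finset.sum_add_distrib]
  have h4 : ∀ i, ((if Z s i = true then a * sgn (if i < t then s else !s) else 0) +
      if Z s i = true then a * sgn (if i + 1 < t then !s else s) else 0) =
      if i = t - 1 then (if 1 ≤ t ∧ Z s i = true then 2 * a * sgn s else 0) else 0 := by
    intro i
    by_cases hi : Z s i = true
    · simp only [hi, if_true, and_true]
      split_ifs <;> first | omega | (cases s <;> simp [sgn] <;> ring)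
    · simp [hi]
  simp_rw [h4, Finset.sum_ite_eq', Finset.mem_range]
  by_cases ht : t - 1 < m
  · simp [ht]
  · simp [ht, hZ (t - 1) (by omega)]

/-- Besides its neighbours on the wire, cell `0` feels the sender and a source holding it at
`false`, cell `L` feels the receiver, and cell `L + 1` feels the memory and a source of opinion
`true`. -/
theorem field_wire (hL : 1 ≤ L) (hZ : ∀ s i, m ≤ i + 1 → Z s i = false) (j : Fin (L + 2)) :
    field K Z t (wire j : Cell L m) =
      (if (j : ℕ) = 0 then (-3 : ℤ) * (L + 3) +
        (if 1 ≤ t ∧ Z true (t - 1) = true then 4 * (L + 3) else 0) else 0) -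
      (if (j : ℕ) = L ∧ 1 ≤ t ∧ Z false (t - 1) = true then 4 * (L + 3) else 0) +
      (if (j : ℕ) = L + 1 then 3 * (L + 3) * (1 + sgn (latch L Z t).2) else 0) +
      ((if (j : ℕ) + 1 < L + 2 then (L + 1 - j) *
        sgn (if (j : ℕ) = L then (latch L Z t).1 else pulse L Z (j + 1) t) else 0) +
      (if 1 ≤ (j : ℕ) then (L + 3 - j) * sgn (pulse L Z (j - 1) t) else 0)) := by
  have hwire := sum_neighbors (L + 2) j j.2 (fun l => ((L + 2 - l : ℕ) : ℤ) *
    sgn (if l = L + 1 then (latch L Z t).1 else pulse L Z l t))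
  have hA := sum_tap (Z := Z) (t := t) true (hZ true) (2 * (L + 3) : ℕ)
  have hB := sum_tap (Z := Z) (t := t) false (hZ false) (2 * (L + 3) : ℕ)
  have hj := j.2
  have hsum : field K Z t (wire j : Cell L m) =
      (if (j : ℕ) = 0 then (-3 : ℤ) * (L + 3) + (∑ b, ∑ i : Fin m, if tap (Z true) true b i = true then
      (2 * (L + 3) : ℕ) * sgn (if (i : ℕ) < t then b else !b) else 0) else 0) +
      (if (j : ℕ) = L then (∑ b, ∑ i : Fin m, if tap (Z false) false b i = true then
      (2 * (L + 3) : ℕ) * sgn (if (i : ℕ) < t then b else !b) else 0) else 0) +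
      (if (j : ℕ) = L + 1 then 3 * (L + 3) * (1 + sgn (latch L Z t).2) else 0) +
      (∑ l : Fin (L + 2), if (l : ℕ) = j + 1 ∨ (j : ℕ) = (l : ℕ) + 1 then
        ((L + 2 - l : ℕ) : ℤ) *
          sgn (if (l : ℕ) = L + 1 then (latch L Z t).1 else pulse L Z l t) else 0) := by
    rw [field, sum_eq]
    simp only [graph_adj, link, size, hub]
    rcases eq_or_ne (j : ℕ) 0 with h0 | h0
    · have h1 : ¬ 0 = L := by omega
      simp [h0, h1, state, sgn_false]
      ring
    · rcases eq_or_ne (j : ℕ) L with h1 | h1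
      · have h2 : ¬ L = 0 := by omega
        simp [h1, h2, state]
      · by_cases h3 : (j : ℕ) = L + 1
        · simp [h3, state, sgn_true]
          ring
        · simp [h0, h1, h3, state]
  rw [hsum, hwire, hA, hB]
  congr 1
  · congr 1
    have h0 : ¬ ((j : ℕ) = 0 ∧ (j : ℕ) = L) := by omega
    simp only [sgn, if_true, Bool.false_eq_true, if_false]
    split_ifs <;> first | tauto | (push_cast; ring)
  · congr 1
    · by_cases h : (j : ℕ) + 1 < L + 2
      · rw [if_pos h, if_pos h, show ((L + 2 - (j + 1) : ℕ) : ℤ) = L + 1 - j by omega]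
        simp only [Nat.add_right_cancel_iff]
      · rw [if_neg h, if_neg h]
    · by_cases h : 1 ≤ (j : ℕ)
      · rw [if_pos h, if_pos h, show ((L + 2 - (j - 1) : ℕ) : ℤ) = L + 3 - j by omega,
          if_neg (by omega)]
      · rw [if_neg h, if_neg h]

end Field

end Cell

/-! ### Evolution, connectivity, levels and sizes of the gadget -/

namespace Cell

variable {L m : ℕ}

theorem field_pos {K : Bool → Bool → ℕ} {Z : Bool → ℕ → Bool} (hL : 1 ≤ L) (hm : 2 ≤ m)
    (hZ : ∀ s i, m ≤ i + 1 → Z s i = false) (hK : ∀ s b, core L m < K s b) (t : ℕ)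
    (k : Cell L m) : 0 < sgn (state Z (t + 1) k) * field K Z t k := by
  cases k with
  | source s b =>
    have := field_source (L := L) (m := m) (K := K) (Z := Z) (t := t) s b
    have := hK s b
    simp only [state]
    omega
  | leaf s b =>
    rw [field_leaf]
    cases b <;> simp only [state, sgn_true, sgn_false] <;> omega
  -- The source's `3` beats one unturned neighbour but not two, so a clock waits for its
  -- predecessor. The last clock has no successor and the opposite source cancels the `3`; it copies
  -- its predecessor, which exists because `2 ≤ m`.
  | clock s b i =>
    have h := abs_le.1 (field_clock (L := L) (K := K) (Z := Z) (t := t) s b i)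
    generalize field K Z t (clock s b i) = F at h ⊢
    have := i.2
    simp only [state]
    cases b <;> simp only [sgn] at h ⊢ <;> split_ifs at h ⊢ <;> first | omega | simp_all
  | memory =>
    rw [field_memory]
    simp only [state, latch]
    cases (latch L Z t).1 <;> decide
  | wire j =>
    have hj := j.2
    rw [field_wire hL hZ]
    rcases eq_or_ne (j : ℕ) (L + 1) with h | h
    -- While the memory is `false` it cancels the source, and wire cell `L` decides; a `true` memory
    -- overrides the wire.
    · simp only [state, h, latch, Nat.add_sub_cancel]
      cases pulse L Z L t <;> cases (latch L Z t).2 <;> simp [sgn] <;> omega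
    rcases Nat.eq_zero_or_pos (j : ℕ) with h0 | h0
    · have h1 : ¬ 0 = L := by omega
      simp only [state, h0, h1, if_true, if_false, false_and]
      generalize pulse L Z (0 + 1) t = x
      have hp : pulse L Z 0 (t + 1) = decide (1 ≤ t ∧ Z true (t - 1) = true) := by
        simp [pulse, show 0 < L by omega, show t + 1 - 2 = t - 1 by omega]
      rw [hp]
      -- The balance is `-3` units of `L + 3` without a pulse and `+1` with one; the next wire cell
      -- weighs only `L + 1`.
      by_cases hc : 1 ≤ t ∧ Z true (t - 1) = true <;> cases x <;> simp [hc, sgn] <;> omega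
    · have hp : pulse L Z j (t + 1) = (pulse L Z (j - 1) t &&
          !decide ((j : ℕ) = L ∧ 1 ≤ t ∧ Z false (t - 1) = true)) := by
        rw [Bool.eq_iff_iff]
        have e : t + 1 - 2 - (j : ℕ) = t - 2 - (j - 1) := by omega
        simp only [pulse, e]
        simp only [show t + 1 - 2 = t - 1 by omega, Bool.and_eq_true, Bool.or_eq_true, decide_eq_true_eq,
          Bool.not_eq_true', decide_eq_false_iff_not, show (j : ℕ) - 1 < L by omega, true_or,
          and_true, show (j : ℕ) + 2 ≤ t + 1 ↔ (j : ℕ) - 1 + 2 ≤ t by omega]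
        constructor
        · rintro ⟨h1, h2⟩
          refine ⟨h1, fun h3 => ?_⟩
          rcases h2 with h2 | h2
          · omega
          · simp [h2] at h3
        · rintro ⟨h1, h2⟩
          refine ⟨h1, ?_⟩
          by_cases h3 : (j : ℕ) < L
          · exact Or.inl h3
          · right
            by_contra h4
            exact h2 ⟨by omega, by omega, by simpa using h4⟩
      simp only [state, h, hp, show ¬ (j : ℕ) = 0 by omega, if_false, show 1 ≤ (j : ℕ) from h0,
        show (j : ℕ) + 1 < L + 2 by omega, if_true]
      generalize (if (j : ℕ) = L then (latch L Z t).1 else pulse L Z (j + 1) t) = x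
      generalize pulse L Z (j - 1) t = y
      -- The preceding cell outweighs the following one by `2`, and a suppression of `4 * (L + 3)`
      -- outweighs both together.
      by_cases hc : (j : ℕ) = L ∧ 1 ≤ t ∧ Z false (t - 1) = true <;> cases x <;> cases y <;>
        simp [hc, sgn] <;> omega

/-- Without ties the rule is symmetric under exchanging opinions. The exchange makes a surviving
pulse cost votes for `1`, so that inclusion is the yes-case of the election. -/
theorem orbit_gadget {K : Bool → Bool → ℕ} {Z : Bool → ℕ → Bool} (hL : 1 ≤ L) (hm : 2 ≤ m)
    (hZ : ∀ s i, m ≤ i + 1 → Z s i = false) (hK : ∀ s b, core L m < K s b) (t : ℕ) :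
    orbit (blowup (graph L m Z) (size K)) (fun v => !state Z 0 v.1) t = fun v => !state Z t v.1 := by
  refine orbit_blowup _ _ (fun t k => !state Z t k) (fun t k => ?_) t
  have h := field_pos hL hm hZ hK t k
  convert h using 1
  rw [field, sgn_not, neg_mul, ← mul_neg, ← Finset.sum_neg_distrib]
  congr 1
  refine Finset.sum_congr rfl fun l _ => ?_
  split_ifs
  · rw [sgn_not, mul_neg, neg_neg]
  · rfl

theorem size_pos {K : Bool → Bool → ℕ} (hK : ∀ s b, 0 < K s b) (k : Cell L m) : 0 < size K k := by
  cases k with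
  | leaf s b => exact hK s b
  | wire j => have := j.2; simp only [size]; omega
  | _ => simp only [size]; omega

theorem connected_gadget {K : Bool → Bool → ℕ} {Z : Bool → ℕ → Bool} (hm : 0 < m)
    (hK : ∀ s b, 0 < K s b) : (blowup (graph L m Z) (size K)).Connected := by
  have hsize : ∀ k : Cell L m, 0 < size K k := size_pos hK
  have hwire : ∀ (j : ℕ) (hj : j < L + 2),
      Joined (graph L m Z) (size K) (wire ⟨0, by omega⟩) (wire ⟨j, hj⟩) := by
    intro j
    induction j with
    | zero =>
      intro hj
      -- Copies of one cell are not adjacent; they are joined through the next cell.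
      have h : Joined (graph L m Z) (size K) (wire ⟨0, by omega⟩) (wire ⟨1, by omega⟩) :=
        .of_adj (graph_adj.2 (by simp [link]))
      exact h.trans (hsize _) h.symm
    | succ j ih =>
      intro hj
      exact (ih (by omega)).trans (hsize _) (.of_adj (graph_adj.2 (by simp [link])))
  have hclock : ∀ s b b' (i : Fin m), b' = b ∨ (i : ℕ) + 1 = m →
      Joined (graph L m Z) (size K) (source s b) (clock s b' i) := fun s b b' i h =>
    .of_adj (graph_adj.2 (by simp [link, h]))
  -- The last clock is adjacent to the sources of both opinions.
  have hflip : ∀ s b b', Joined (graph L m Z) (size K) (source s b) (source s b') := fun s b b' =>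
    (hclock s b b' ⟨m - 1, by omega⟩ (Or.inr (by simp; omega))).trans (hsize _)
      (hclock s b' b' _ (Or.inl rfl)).symm
  have hsource : ∀ s b, Joined (graph L m Z) (size K) (wire ⟨0, by omega⟩) (source s b) := by
    intro s b
    cases s
    · have h : Joined (graph L m Z) (size K) (wire ⟨L + 1, by omega⟩) (source false true) :=
        .of_adj (graph_adj.2 (by simp [link]))
      exact ((hwire _ _).trans (hsize _) h).trans (hsize _) (hflip _ _ _)
    · have h : Joined (graph L m Z) (size K) (wire ⟨0, by omega⟩) (source true false) :=
        .of_adj (graph_adj.2 (by simp [link]))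
      exact h.trans (hsize _) (hflip _ _ _)
  refine connected_blowup (hsize (wire ⟨0, by omega⟩)) fun k => ?_
  cases k with
  | source s b => exact hsource s b
  | leaf s b => exact (hsource s b).trans (hsize _) (.of_adj (graph_adj.2 (by simp [link])))
  | clock s b i => exact (hsource s b).trans (hsize _) (hclock s b b i (Or.inl rfl))
  | wire j => exact hwire j j.2
  | memory =>
    exact (hwire (L + 1) (by omega)).trans (hsize _) (.of_adj (graph_adj.2 (by simp [link])))

/-- The position of a cell between the sender and the receiver. -/
def level : Cell L m → ℕ
  | source s _ => if s then 0 else L + 2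
  | leaf s _ => if s then 0 else L + 2
  | clock s _ _ => if s then 0 else L + 2
  | wire j => j + 1
  | memory => L + 2

theorem level_le_of_adj {Z : Bool → ℕ → Bool} {k l : Cell L m} (h : (graph L m Z).Adj k l) :
    level l ≤ level k + 1 := by
  rw [graph_adj] at h
  cases k <;> cases l <;> simp [link, level, hub] at h ⊢ <;> grind

/-- Only edges from a clock to the wire depend on `Z`, through the side of the clock; the level
conditions exclude the clocks of side `!s`. -/
theorem adj_congr {Z Z' : Bool → ℕ → Bool} {k l : Cell L m} (s : Bool) (hs : Z s = Z' s)
    (hk : level k ≠ if s then L + 2 else 0) (hl : level l ≠ if s then L + 2 else 0) :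
    (graph L m Z).Adj k l ↔ (graph L m Z').Adj k l := by
  have h : ∀ k l : Cell L m, level k ≠ (if s then L + 2 else 0) → link Z k l = link Z' k l := by
    intro k l hk
    cases k <;> cases l <;> try rfl
    rename_i s' b i j
    have : s' = s := by cases s <;> cases s' <;> simp_all [level]
    simp only [link, this, hs]
  rw [graph_adj, graph_adj, h k l hk, h l k hl]

/-- The opinions when the clocks have run and no signal has got through. -/
def final : Cell L m → Bool
  | source _ b => b
  | leaf _ b => b
  | clock _ b _ => b
  | wire _ => false
  | memory => false

theorem card_filter (size : Cell L m → ℕ) (p : Cell L m → Bool) :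
    (Finset.univ.filter fun v : Σ k, Fin (size k) => p v.1 = true).card =
      ∑ k, if p k = true then size k else 0 := by
  rw [Finset.card_filter, Fintype.sum_sigma]
  refine Finset.sum_congr rfl fun k _ => ?_
  split_ifs <;> simp

theorem exists_leaf_sizes (L m n : ℕ) (hn : 8 * core L m + 8 ≤ n) :
    ∃ K : Bool → Bool → ℕ, (∀ s b, core L m < K s b) ∧
      ∑ k : Cell L m, size K k = n ∧
      ∑ k : Cell L m, (if (!final k) = true then size K k else 0) = n / 2 + 1 := by
  let c := core L m
  let w := ∑ j : Fin (L + 2), (L + 2 - (j : ℕ))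
  -- This counts the nodes with `final` value `false` apart from the receiver's `false` leaves.
  -- Those leaves, `b` in number, then bring the count to `n / 2 + 1`, and `a` brings the total to
  -- `n`.
  let idle := 9 * (L + 3) + 4 * m * (L + 3) + w + (c + 1)
  have hidle : idle ≤ 2 * c + 1 := by
    simp only [idle, c, core, w]
    nlinarith
  let b := n / 2 + 1 - idle
  let a := n - c - 2 * (c + 1) - b
  refine ⟨fun s o => if s then c + 1 else if o then a else b, ?_, ?_, ?_⟩
  · intro s o
    cases s <;> cases o <;> simp [a, b] <;> omega
  · rw [sum_eq]
    have hc : c = 15 * (L + 3) + 8 * m * (L + 3) + w := rfl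
    simp [size]
    have : (∑ j : Fin (L + 2), (L + 2 - (j : ℕ))) = w := rfl
    rw [this]
    have h1 : m * (2 * (L + 3)) = 2 * (m * (L + 3)) := by ring
    have h2 : 8 * m * (L + 3) = 8 * (m * (L + 3)) := by ring
    rw [h1]
    rw [h2] at hc
    omega
  · rw [sum_eq]
    simp [size, final]
    have : (∑ j : Fin (L + 2), (L + 2 - (j : ℕ))) = w := rfl
    rw [this]
    have h1 : m * (2 * (L + 3)) = 2 * (m * (L + 3)) := by ring
    have h2 : 4 * m * (L + 3) = 4 * (m * (L + 3)) := by ring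
    have hi : idle = 9 * (L + 3) + 4 * m * (L + 3) + w + (c + 1) := rfl
    rw [h1]
    rw [h2] at hi
    omega

theorem card_wire_le (K : Bool → Bool → ℕ) :
    Fintype.card {v : Σ k : Cell L m, Fin (size K k) // 0 < level v.1 ∧ level v.1 < L + 2} ≤
      (L + 2) * (L + 2) := by
  rw [Fintype.card_subtype]
  have h := card_filter (size K) (fun k : Cell L m => decide (0 < level k ∧ level k < L + 2))
  simp only [decide_eq_true_eq] at h
  rw [h, sum_eq]
  simp only [level, size]
  simp
  calc _ ≤ ∑ j : Fin (L + 2), (L + 2) := by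
        refine Finset.sum_le_sum fun j _ => ?_
        split_ifs <;> omega
    _ = _ := by simp

end Cell

/-! ### Encoding set inclusion -/

namespace Cell

variable {L M : ℕ}

/-- The function of natural numbers that extends `X` by `false`. -/
def extend (X : Fin M → Bool) (i : ℕ) : Bool := if h : i < M then X ⟨i, h⟩ else false

theorem extend_eq_false (X : Fin M → Bool) {i : ℕ} (h : M ≤ i) : extend X i = false :=
  dif_neg (by omega)

/-- The sender has the set `X`; the receiver has the set `Y`, delayed by the length of the wire. -/
def schedule (L : ℕ) (X Y : Fin M → Bool) : Bool → ℕ → Bool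
  | true => extend X
  | false => fun i => decide (L ≤ i) && extend Y (i - L)

theorem schedule_eq_false (X Y : Fin M → Bool) (s : Bool) (i : ℕ) (h : M + L + 1 ≤ i + 1) :
    schedule L X Y s i = false := by
  cases s
  · simp [schedule, extend_eq_false Y (show M ≤ i - L by omega)]
  · exact extend_eq_false X (by omega)

theorem pulse_eq_false (X Y : Fin M → Bool) {j t : ℕ} (h : M + j + 2 ≤ t) :
    pulse L (schedule L X Y) j t = false := by
  simp [pulse, schedule, extend_eq_false X (show M ≤ t - 2 - j by omega)]

/-- The pulse of `i` would reach wire cell `L` at time `i + L + 2`, exactly when the delayed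
schedule suppresses it if `Y i` holds. -/
theorem latch_eq_false {X Y : Fin M → Bool} (h : ∀ i, X i = true → Y i = true) (t : ℕ) :
    latch L (schedule L X Y) t = (false, false) := by
  induction t with
  | zero => rfl
  | succ t ih =>
    have hp : pulse L (schedule L X Y) L t = false := by
      rw [Bool.eq_false_iff]
      intro hc
      simp only [pulse, schedule, Bool.and_eq_true, decide_eq_true_eq,
        lt_irrefl, decide_false, Bool.false_or, Bool.not_eq_true', Bool.and_eq_false_iff,
        decide_eq_false_iff_not] at hc
      obtain ⟨⟨h1, h2⟩, h3⟩ := hc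
      rcases h3 with h3 | h3
      · omega
      · unfold extend at h2 h3
        split_ifs at h2 h3 with hi
        rw [h _ h2] at h3
        exact absurd h3 (by simp)
    rw [latch, ih, hp]
    rfl

/-- An unsuppressed pulse enters the latch, where each of the two cells hands `true` to the other at
every step. -/
theorem latch_alive {X Y : Fin M → Bool} {i : Fin M} (hX : X i = true) (hY : Y i = false) (t : ℕ)
    (ht : M + L + 2 ≤ t) :
    (latch L (schedule L X Y) t).1 = true ∨ (latch L (schedule L X Y) t).2 = true := by
  have hi := i.2
  have hp : pulse L (schedule L X Y) L (i + L + 2) = true := by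
    simp [pulse, schedule, extend, show (i : ℕ) + L - L = i by omega, hX, hY]
  have h : ∀ d : ℕ, (latch L (schedule L X Y) (i + L + 2 + 1 + d)).1 = true ∨
      (latch L (schedule L X Y) (i + L + 2 + 1 + d)).2 = true := by
    intro d
    induction d with
    | zero => left; simp [latch, hp]
    | succ d ih =>
      rw [← add_assoc, latch]
      rcases ih with ih | ih
      · exact Or.inr ih
      · left; simp [ih]
  obtain ⟨d, rfl⟩ := Nat.exists_eq_add_of_le (show (i : ℕ) + L + 2 + 1 ≤ t by omega)
  exact h d

theorem state_eq_final {X Y : Fin M → Bool} {t : ℕ} (ht : M + L + 2 ≤ t)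
    (k : Cell L (M + L + 1)) :
    state (schedule L X Y) t k = match k with
      | wire j => decide ((j : ℕ) = L + 1) && (latch L (schedule L X Y) t).1
      | memory => (latch L (schedule L X Y) t).2
      | k => final k := by
  cases k with
  | clock s b i =>
    have := i.2
    simp only [state, final]
    rw [if_pos (by omega)]
  | wire j =>
    have := j.2
    simp only [state]
    split_ifs with h
    · simp [h]
    · rw [pulse_eq_false X Y (by omega)]
      simp [h]
  | _ => rfl

theorem state_eq_final_of_imp {X Y : Fin M → Bool} (h : ∀ i, X i = true → Y i = true) {t : ℕ}
    (ht : M + L + 2 ≤ t) (k : Cell L (M + L + 1)) : state (schedule L X Y) t k = final k := by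
  rw [state_eq_final ht, latch_eq_false h]
  cases k <;> simp [final]

theorem exists_state_ne_final {X Y : Fin M → Bool} (h : ¬ ∀ i, X i = true → Y i = true) {t : ℕ}
    (ht : M + L + 2 ≤ t) :
    ∃ k : Cell L (M + L + 1), final k = false ∧ state (schedule L X Y) t k = true := by
  push Not at h
  obtain ⟨i, hX, hY⟩ := h
  rcases latch_alive (L := L) hX (by simpa using hY) t ht with h | h
  · exact ⟨wire (Fin.last _), rfl, by rw [state_eq_final ht]; simp [h]⟩
  · exact ⟨memory, rfl, by rw [state_eq_final ht]; simp [h]⟩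

theorem state_eq_true_of_final {X Y : Fin M → Bool} {t : ℕ} (ht : M + L + 2 ≤ t)
    {k : Cell L (M + L + 1)} (h : final k = true) : state (schedule L X Y) t k = true := by
  rw [state_eq_final ht]
  cases k <;> simp_all [final]

end Cell

/-! ### From inclusion to certificate size -/

open Cell

theorem exists_isIdAssignment {c : ℝ} (hc : 1 < c) (V : Type) [Fintype V] :
    ∃ id : V → ℕ, IsIdAssignment c id := by
  refine ⟨fun v => Fintype.equivFin V v + 1, fun u v h => ?_, fun v => ⟨Nat.succ_pos _, ?_⟩⟩
  · exact (Fintype.equivFin V).injective (Fin.ext (by simpa using h))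
  · have h := (Fintype.equivFin V v).2
    have h1 : (1 : ℝ) ≤ Fintype.card V := by exact_mod_cast Fintype.card_pos_iff.2 ⟨v⟩
    calc ((Fintype.equivFin V v + 1 : ℕ) : ℝ) ≤ Fintype.card V := by exact_mod_cast h
      _ = (Fintype.card V : ℝ) ^ (1 : ℝ) := (Real.rpow_one _).symm
      _ ≤ _ := Real.rpow_le_rpow_of_exponent_le h1 hc.le

/-- A language whose instances on the gadget encode the inclusion of the sender's set in the
receiver's set has no small certificates. -/
theorem le_size_of_decides_inclusion {S : Type} {A : TimedLanguage S} {c : ℝ} (hc : 1 < c)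
    {r L M : ℕ} (hL : 2 * r < L + 2) (P : LocallyCheckableProof A c r)
    (K : Bool → Bool → ℕ) (hK : ∀ s b, core L (M + L + 1) < K s b)
    (s : (Σ k : Cell L (M + L + 1), Fin (size K k)) → S) (T : ℕ)
    (hA : ∀ X Y : Fin M → Bool,
      A _ (blowup (graph L (M + L + 1) (schedule L X Y)) (size K)) s T ↔
        ∀ i, X i = true → Y i = true) :
    M ≤ 2 * (P.size (∑ k : Cell L (M + L + 1), size K k) * ((L + 2) * (L + 2))) := by
  obtain ⟨id, hid⟩ := exists_isIdAssignment hc (Σ k : Cell L (M + L + 1), Fin (size K k))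
  have h := card_le_of_fooling P
    (fun X Y : Fin M → Bool => blowup (graph L (M + L + 1) (schedule L X Y)) (size K)) id s T
    (fun v => level v.1) (L + 2) hL hid
    (fun X Y => connected_gadget (by omega) fun s b => (hK s b).pos)
    (fun X Y u v huv => level_le_of_adj huv)
    (fun X Y Y' u v hu hv => adj_congr true rfl hu.ne hv.ne)
    (fun X X' Y u v hu hv => adj_congr false rfl hu.ne' hv.ne')
    (fun X => (hA X X).2 fun _ h => h)
    (fun X Y h h' => funext fun i => Bool.eq_iff_iff.2 ⟨(hA X Y).1 h i, (hA Y X).1 h' i⟩)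
  have hcard : Fintype.card (Σ k : Cell L (M + L + 1), Fin (size K k)) = ∑ k : Cell L (M + L + 1), size K k := by
    simp
  rw [hcard] at h
  have h2 : 2 ^ M ≤ 2 ^ (2 * (P.size (∑ k : Cell L (M + L + 1), size K k) *
      ((L + 2) * (L + 2)))) := by
    calc 2 ^ M = Fintype.card (Fin M → Bool) := by simp
      _ ≤ _ := h
      _ ≤ 3 ^ (P.size (∑ k : Cell L (M + L + 1), size K k) * ((L + 2) * (L + 2))) :=
        Nat.pow_le_pow_right (by norm_num) (Nat.mul_le_mul_left _ (card_wire_le K))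
      _ ≤ 4 ^ (P.size (∑ k : Cell L (M + L + 1), size K k) * ((L + 2) * (L + 2))) :=
        Nat.pow_le_pow_left (by norm_num) _
      _ = _ := by rw [pow_mul 2 2]; norm_num
  exact (Nat.pow_le_pow_iff_right (by norm_num)).1 h2

/-- The state at time `0` does not depend on the schedule, so one input serves all pairs `X`, `Y`.
-/
theorem orbit_schedule {L M : ℕ} (hL : 1 ≤ L) (K : Bool → Bool → ℕ)
    (hK : ∀ s b, core L (M + L + 1) < K s b) (X Y : Fin M → Bool) (t : ℕ) :
    orbit (blowup (graph L (M + L + 1) (schedule L X Y)) (size K))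
      (fun v => !state (fun _ _ => false) 0 v.1) t = fun v => !state (schedule L X Y) t v.1 := by
  rw [← orbit_gadget hL (by omega) (schedule_eq_false X Y) hK t]
  congr 1

theorem majorityPrediction_gadget {L M : ℕ} (hL : 1 ≤ L) (K : Bool → Bool → ℕ)
    (hK : ∀ s b, core L (M + L + 1) < K s b) (X Y : Fin M → Bool) :
    MajorityPrediction (Σ k : Cell L (M + L + 1), Fin (size K k))
      (blowup (graph L (M + L + 1) (schedule L X Y)) (size K))
      (fun v => (!state (fun _ _ => false) 0 v.1, !final v.1)) (M + L + 2) ↔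
        ∀ i, X i = true → Y i = true := by
  simp only [MajorityPrediction]
  rw [orbit_schedule hL K hK]
  constructor
  · rintro ⟨-, h⟩
    by_contra hXY
    obtain ⟨k, h1, h2⟩ := exists_state_ne_final (L := L) hXY le_rfl
    have hk := size_pos (fun s b => (hK s b).pos) k
    have := congrFun h ⟨k, ⟨0, hk⟩⟩
    simp [h1, h2] at this
  · intro h
    exact ⟨by omega, funext fun v => by rw [state_eq_final_of_imp h le_rfl]⟩

/-- The idle count `n / 2 + 1` is the least strict majority. A surviving pulse only removes votes,
and at least one, so it loses the election. -/
theorem electionPrediction_gadget {L M n : ℕ} (hL : 1 ≤ L) (K : Bool → Bool → ℕ)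
    (hK : ∀ s b, core L (M + L + 1) < K s b) (hn : ∑ k : Cell L (M + L + 1), size K k = n)
    (hidle : ∑ k : Cell L (M + L + 1), (if (!final k) = true then size K k else 0) = n / 2 + 1)
    (X Y : Fin M → Bool) :
    ElectionPrediction (Σ k : Cell L (M + L + 1), Fin (size K k))
      (blowup (graph L (M + L + 1) (schedule L X Y)) (size K))
      (fun v => !state (fun _ _ => false) 0 v.1) (M + L + 2) ↔ ∀ i, X i = true → Y i = true := by
  have hcard : Fintype.card (Σ k : Cell L (M + L + 1), Fin (size K k)) = n := by simp [← hn]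
  have half_lt : ∀ a : ℕ, (n : ℝ) / 2 < a ↔ n < a * 2 := by
    intro a
    rw [div_lt_iff₀ (by norm_num)]
    exact_mod_cast Iff.rfl
  simp only [ElectionPrediction]
  rw [orbit_schedule hL K hK, hcard, card_filter (size K)
    (fun k => !state (schedule L X Y) (M + L + 2) k), half_lt]
  constructor
  · rintro ⟨-, h⟩
    by_contra hXY
    obtain ⟨k, h1, h2⟩ := exists_state_ne_final (L := L) hXY le_rfl
    have hk := size_pos (fun s b => (hK s b).pos) k
    have hlt : ∑ k : Cell L (M + L + 1),
        (if (!state (schedule L X Y) (M + L + 2) k) = true then size K k else 0) <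
        ∑ k : Cell L (M + L + 1), (if (!final k) = true then size K k else 0) := by
      refine Finset.sum_lt_sum (fun k _ => ?_) ⟨k, Finset.mem_univ _, by simpa [h1, h2] using hk⟩
      cases hf : final k
      · simp only [Bool.not_false, if_true]
        split_ifs <;> simp
      · simp [state_eq_true_of_final (X := X) (Y := Y) le_rfl hf]
    omega
  · intro h
    simp only [state_eq_final_of_imp h le_rfl, hidle]
    omega

end MajorityDynamics

theorem theorem6 (r : ℕ) :
    ∃ κ : ℝ, 0 < κ ∧ ∃ N : ℕ, ∀ c : ℝ, 1 < c →
      (∀ P : MajorityDynamics.LocallyCheckableProof MajorityDynamics.ElectionPrediction c r,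
        ∀ n : ℕ, N ≤ n → κ * (n : ℝ) ≤ (P.size n : ℝ)) ∧
      (∀ P : MajorityDynamics.LocallyCheckableProof MajorityDynamics.MajorityPrediction c r,
        ∀ n : ℕ, N ≤ n → κ * (n : ℝ) ≤ (P.size n : ℝ)) := by
  open MajorityDynamics Cell in
  obtain ⟨L, hL, hr⟩ : ∃ L, 1 ≤ L ∧ 2 * r < L + 2 := ⟨2 * r + 1, by omega, by omega⟩
  -- With `M = n / D`, eight times the part of `core` linear in `M` is `64 * (L + 3) * M`, at most
  -- `n / 2`; the constant part `C` is absorbed by the threshold on `n`.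
  let D := 128 * (L + 3)
  let W := (L + 2) * (L + 2)
  let C := core L (L + 1)
  have hW : 0 < W := by positivity
  have bound : ∀ n s : ℕ, D ≤ n → n / D ≤ 2 * (s * W) →
      1 / (4 * D * W : ℝ) * (n : ℝ) ≤ (s : ℝ) := by
    intro n s hn h
    have h1 : 1 ≤ n / D := (Nat.one_le_div_iff (by positivity)).2 hn
    have h2 : n < D * (n / D + 1) := Nat.lt_mul_div_succ n (by positivity)
    have h3 : n ≤ s * (4 * D * W) := by
      calc n ≤ D * (n / D + 1) := h2.le
        _ ≤ D * (2 * (n / D)) := by gcongr; omega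
        _ ≤ D * (2 * (2 * (s * W))) := by gcongr
        _ = _ := by ring
    rw [one_div_mul_eq_div, div_le_iff₀ (by positivity)]
    exact_mod_cast h3
  have large : ∀ n : ℕ, D + 16 * C + 16 ≤ n → 8 * core L (n / D + L + 1) + 8 ≤ n := by
    intro n hn
    have h1 : D * (n / D) ≤ n := Nat.mul_div_le n D
    have h2 : core L (n / D + L + 1) = C + 8 * (L + 3) * (n / D) := by
      simp only [core, C]
      ring
    have h3 : D * (n / D) = 16 * (8 * (L + 3) * (n / D)) := by
      simp only [D]
      ring
    omega
  refine ⟨1 / (4 * D * W : ℝ), by positivity, D + 16 * C + 16, fun c hc => ⟨?_, ?_⟩⟩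
  · intro P n hn
    obtain ⟨K, hK, hsum, hidle⟩ := exists_leaf_sizes L (n / D + L + 1) n (large n hn)
    refine bound _ _ (by omega) ?_
    have h := le_size_of_decides_inclusion hc hr P K hK _ _
      (electionPrediction_gadget hL K hK hsum hidle)
    rwa [hsum] at h
  · intro P n hn
    obtain ⟨K, hK, hsum, -⟩ := exists_leaf_sizes L (n / D + L + 1) n (large n hn)
    refine bound _ _ (by omega) ?_
    have h := le_size_of_decides_inclusion hc hr P K hK _ _ (majorityPrediction_gadget hL K hK)
    rwa [hsum] at h
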